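/- For complex numbers $a, a_1,\dots,a_m, q$ with $|q|<1$ and $n\ge 0$ put $$(a;q)_n=\prod_{k=0}^{n-1}(1-aq^k),\qquad (a;q)_\infty=\prod_{k=0}^{\infty}(1-aq^k),\qquad (a_1,\dots,a_m;q)_\infty=\prod_{l=1}^m (a_l;q)_\infty .$$ Then for every complex $q$ with $|q|<1$ the following four double series converge absolutely and \begin{align*} \sum_{i,j\ge 0}\frac{q^{2i^2+2ij+\frac12 j^2+\frac12 j}}{(q;q)_{2i}(q;q)_j}&=\frac{(q^{4},q^{16},q^{20};q^{20})_\infty\,(q^{12},q^{28};q^{40})_\infty}{(q;q)_\infty},\\ \sum_{i,j\ge 0}\frac{q^{2i^2+2ij+\frac12 j^2+2i+\frac32 j}}{(q;q)_{2i+1}(q;q)_j}&=\frac{(q^{6},q^{14},q^{20};q^{20})_\infty\,(q^{8},q^{32};q^{40})_\infty}{(q;q)_\infty},\\ \sum_{i,j\ge 0}\frac{q^{2i^2+2ij+\frac12 j^2+2i+\frac12 j}}{(q;q)_{2i}(q;q)_j}&=\frac{(q^{2},q^{18},q^{20};q^{20})_\infty\,(q^{16},q^{24};q^{40})_\infty}{(q;q)_\infty},\\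 \sum_{i,j\ge 0}\frac{q^{2i^2+2ij+\frac12 j^2+4i+\frac32 j}}{(q;q)_{2i+1}(q;q)_j}&=\frac{(q^{8},q^{12},q^{20};q^{20})_\infty\,(q^{4},q^{36};q^{40})_\infty}{(q;q)_\infty}. \end{align*} -/

import Mathlib

/-- The finite `q`-shifted factorial `(a; q)_n = (1 - a)(1 - a q) ⋯ (1 - a q ^ (n - 1))`. -/
noncomputable def qPochhammer (a q : ℂ) (n : ℕ) : ℂ :=
  ∏ k ∈ Finset.range n, (1 - a * q ^ k)

/-- The infinite `q`-shifted factorial `(a; q)_∞ = ∏_{k ≥ 0} (1 - a q ^ k)`, for `‖q‖ < 1`. -/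
noncomputable def qPochhammerInf (a q : ℂ) : ℂ :=
  ∏' k : ℕ, (1 - a * q ^ k)

/-- The compressed notation `(a₁, …, aₘ; q)_∞ = (a₁; q)_∞ ⋯ (aₘ; q)_∞`. -/
noncomputable def qPochhammerInfs (as : List ℂ) (q : ℂ) : ℂ :=
  (as.map fun a => qPochhammerInf a q).prod

/-- The infinite product defining `(a; q)_∞` converges for `‖q‖ < 1`, so that the `∏'` in its
definition takes its genuine value there. -/
theorem multipliable_qPochhammerInf (a : ℂ) {q : ℂ} (hq : ‖q‖ < 1) :
    Multipliable fun k : ℕ => 1 - a * q ^ k := by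
  have h : Summable fun k : ℕ => ‖-(a * q ^ k)‖ := by
    simpa [norm_mul, norm_pow] using
      (summable_geometric_of_lt_one (norm_nonneg q) hq).mul_left ‖a‖
  simpa [sub_eq_add_neg] using multipliable_one_add_of_summable h

/-! Summing over `j` first, Euler's expansion gives `∑_j q^{j(j+1)/2 + nj} / (q;q)_j =
(-q^{n+1};q)_∞`. Since `(q;q)_n (-q;q)_n = (q²;q²)_n`, each double series equals `(-q;q)_∞` times a
single Rogers–Slater series in base `q²`, such as `∑ q^{2i²} / (q²;q²)_{2i}`
(`hasSum_double_of_hasSum`).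

The single series are evaluated by the limiting Bailey lemma (`hasSum_bailey`), which is Durfee's
rectangle identity plus an interchange of summation. Its input is a family of Schur-type finite
identities writing `1/(q;q)_{2n}` and `1/(q;q)_{2n+1}`, possibly times `q^n`, as differences of two
bilateral sums (`schurSum_even`, `schurSum_odd` and their primed variants). The output is a
difference of two theta series with quadratic part `15r²`.

Such a difference is the series side of the quintuple product at `p = q⁵`, `z = q^c`
(`thetaSum_sub_thetaSum`); `c = 2, 3, 1, 4` give the four products. The case `q = 0` is separate
because integer powers of `q` are used. -/

open Filter Topology

/-! ### Reciprocal `q`-factorials with integer index. -/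

/-- The reciprocal `1 / (q; q)_n`, extended by zero to negative `n`. -/
noncomputable def qFactInv (q : ℂ) (n : ℤ) : ℂ :=
  if 0 ≤ n then (qPochhammer q q n.toNat)⁻¹ else 0

theorem qPochhammer_zero (a q : ℂ) : qPochhammer a q 0 = 1 := by
  simp [qPochhammer]

theorem qPochhammer_succ (a q : ℂ) (n : ℕ) :
    qPochhammer a q (n + 1) = qPochhammer a q n * (1 - a * q ^ n) := by
  simp [qPochhammer, Finset.prod_range_succ]

theorem one_sub_pow_ne_zero {q : ℂ} (hq : ‖q‖ < 1) {n : ℕ} (hn : n ≠ 0) : 1 - q ^ n ≠ 0 := by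
  intro h
  have h1 : ‖q ^ n‖ = 1 := by rw [← sub_eq_zero.mp h]; simp
  rw [norm_pow] at h1
  exact absurd h1 (pow_lt_one₀ (norm_nonneg q) hq hn).ne

theorem qPochhammer_self_ne_zero {q : ℂ} (hq : ‖q‖ < 1) (n : ℕ) : qPochhammer q q n ≠ 0 := by
  refine Finset.prod_ne_zero_iff.mpr fun k _ => ?_
  rw [← pow_succ']
  exact one_sub_pow_ne_zero hq (Nat.succ_ne_zero k)

theorem tendsto_qPochhammer (a : ℂ) {q : ℂ} (hq : ‖q‖ < 1) :
    Tendsto (qPochhammer a q) atTop (𝓝 (qPochhammerInf a q)) :=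
  (multipliable_qPochhammerInf a hq).tendsto_prod_tprod_nat

theorem qPochhammerInf_self_ne_zero {q : ℂ} (hq : ‖q‖ < 1) : qPochhammerInf q q ≠ 0 := by
  have h := tprod_one_add_ne_zero_of_summable (f := fun k : ℕ => -(q * q ^ k))
    (fun k => by
      have := one_sub_pow_ne_zero hq (Nat.succ_ne_zero k)
      rwa [pow_succ', sub_eq_add_neg] at this)
    (by simpa [norm_mul, norm_pow] using
      (summable_geometric_of_lt_one (norm_nonneg q) hq).mul_left ‖q‖)
  simpa [qPochhammerInf, sub_eq_add_neg] using h

theorem qFactInv_natCast (q : ℂ) (n : ℕ) : qFactInv q n = (qPochhammer q q n)⁻¹ := by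
  simp [qFactInv]

theorem qFactInv_of_neg (q : ℂ) {n : ℤ} (hn : n < 0) : qFactInv q n = 0 := by
  simp [qFactInv, not_le.mpr hn]

theorem qFactInv_zero (q : ℂ) : qFactInv q 0 = 1 := by
  simp [qFactInv, qPochhammer_zero]

/-- The zero extension is what makes this hold for all integers: at `n = 0` the factor `1 - q^0`
vanishes. The `q`-Pascal recurrences built on it therefore need no boundary cases. -/
theorem qFactInv_sub_one {q : ℂ} (hq : ‖q‖ < 1) (n : ℤ) :
    qFactInv q (n - 1) = (1 - q ^ n) * qFactInv q n := by
  rcases lt_trichotomy n 0 with h | rfl | h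
  · rw [qFactInv_of_neg q h, qFactInv_of_neg q (by omega), mul_zero]
  · simp [qFactInv]
  · obtain ⟨m, rfl⟩ : ∃ m : ℕ, n = m + 1 := ⟨(n - 1).toNat, by omega⟩
    have h1 := one_sub_pow_ne_zero hq (Nat.succ_ne_zero m)
    have h2 := qPochhammer_self_ne_zero hq m
    rw [add_sub_cancel_right, ← Nat.cast_succ, qFactInv_natCast, qFactInv_natCast,
      qPochhammer_succ, zpow_natCast, ← pow_succ', mul_inv]
    field_simp

theorem tendsto_qFactInv {q : ℂ} (hq : ‖q‖ < 1) :
    Tendsto (qFactInv q) atTop (𝓝 (qPochhammerInf q q)⁻¹) := by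
  have h := (tendsto_qPochhammer q hq).inv₀ (qPochhammerInf_self_ne_zero hq)
  have ht : Tendsto Int.toNat atTop atTop := tendsto_atTop.mpr fun b => by
    filter_upwards [eventually_ge_atTop (b : ℤ)] with n hn
    omega
  refine (h.comp ht).congr' ?_
  filter_upwards [eventually_ge_atTop 0] with n hn
  simp [qFactInv, hn]

theorem exists_norm_qFactInv_le {q : ℂ} (hq : ‖q‖ < 1) :
    ∃ C : ℝ, 0 ≤ C ∧ ∀ n, ‖qFactInv q n‖ ≤ C := by
  have h := (tendsto_qPochhammer q hq).inv₀ (qPochhammerInf_self_ne_zero hq)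
  obtain ⟨C, hC⟩ := h.norm.bddAbove_range
  have hC' : ∀ n, ‖(qPochhammer q q n)⁻¹‖ ≤ C := fun n => hC ⟨n, rfl⟩
  have h0 : 0 ≤ C := (norm_nonneg _).trans (hC' 0)
  refine ⟨C, h0, fun n => ?_⟩
  unfold qFactInv
  split_ifs
  · exact hC' _
  · simpa using h0

theorem summable_mul_qFactInv_mul {ι : Type*} {q : ℂ} (hq : ‖q‖ < 1) {c : ι → ℂ}
    (hc : Summable c) (f g : ι → ℤ) :
    Summable fun k => c k * (qFactInv q (f k) * qFactInv q (g k)) := by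
  obtain ⟨C, hC0, hC⟩ := exists_norm_qFactInv_le hq
  refine Summable.of_norm_bounded (hc.norm.mul_right (C * C)) fun k => ?_
  rw [norm_mul, norm_mul]
  gcongr <;> exact hC _

/-! ### Theta series, the Jacobi triple product and Euler's expansion. -/

theorem summable_pow_sq_mul_pow {p : ℂ} (hp : ‖p‖ < 1) (z : ℂ) :
    Summable fun n : ℕ => p ^ n ^ 2 * z ^ n := by
  have hl : Tendsto (fun n : ℕ => ‖p ^ (2 * n + 1) * z‖) atTop (𝓝 0) := by
    have h1 : Tendsto (fun n : ℕ => p ^ (2 * n + 1)) atTop (𝓝 0) :=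
      (tendsto_pow_atTop_nhds_zero_of_norm_lt_one hp).comp
        (tendsto_atTop_mono (fun n => show n ≤ 2 * n + 1 by omega) tendsto_id)
    simpa using (h1.mul_const z).norm
  refine summable_of_ratio_norm_eventually_le (r := 1 / 2) (by norm_num) ?_
  filter_upwards [hl.eventually_le_const (show (0 : ℝ) < 1 / 2 by norm_num)] with n hn
  have : p ^ (n + 1) ^ 2 * z ^ (n + 1) = p ^ (2 * n + 1) * z * (p ^ n ^ 2 * z ^ n) := by
    ring
  rw [this, norm_mul]
  gcongr

theorem summable_zpow_sq_mul_zpow {p : ℂ} (hp : ‖p‖ < 1) (z : ℂ) :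
    Summable fun n : ℤ => p ^ n ^ 2 * z ^ n := by
  refine Summable.of_nat_of_neg ?_ ?_
  · exact_mod_cast summable_pow_sq_mul_pow hp z
  · refine (summable_pow_sq_mul_pow hp z⁻¹).congr fun n => ?_
    rw [neg_sq, zpow_neg, inv_pow]
    norm_cast

theorem summable_zpow_quadratic {q : ℂ} (hq : ‖q‖ < 1) (hq0 : q ≠ 0) {a : ℕ} (ha : a ≠ 0)
    (b c : ℤ) : Summable fun n : ℤ => q ^ (a * n ^ 2 + b * n + c) := by
  have h := (summable_zpow_sq_mul_zpow (p := q ^ a)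
    (by rw [norm_pow]; exact pow_lt_one₀ (norm_nonneg q) hq ha) (q ^ b)).mul_right (q ^ c)
  refine h.congr fun n => ?_
  rw [zpow_add₀ hq0, zpow_add₀ hq0, zpow_mul, zpow_mul, zpow_natCast]

theorem HasSum.of_eq {ι : Type*} {f g : ι → ℂ} {s t : ℂ} (h : HasSum g t) (hf : ∀ i, f i = g i)
    (hs : s = t) : HasSum f s := by
  rwa [funext hf, hs]

theorem HasSum.mul_prod {ι κ : Type*} {f : ι → ℂ} {g : κ → ℂ} {s t : ℂ} (hf : HasSum f s)
    (hg : HasSum g t) : HasSum (fun x : ι × κ => f x.1 * g x.2) (s * t) := by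
  have h := summable_mul_of_summable_norm hf.summable.norm hg.summable.norm
  exact hf.mul hg h

/-- With `Q = p²`, split `1 - Q^{a+b+1} = (1 - Q^{b+1-k}) + Q^{b+1-k} (1 - Q^{a+k})`. The first
piece is the summand for `b`; the second is `p^{2b+1} z` times that summand at `k - 1`. -/
theorem hasSum_theta_mul_qFactInv_succ {p : ℂ} (hp : ‖p‖ < 1) (hp0 : p ≠ 0) {z : ℂ} (hz : z ≠ 0)
    {a b : ℕ} {S : ℂ}
    (h : HasSum (fun k : ℤ =>
      p ^ k ^ 2 * z ^ k * (qFactInv (p ^ 2) (a + k) * qFactInv (p ^ 2) (b - k)))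
      (qFactInv (p ^ 2) (a + b) * S)) :
    HasSum (fun k : ℤ =>
      p ^ k ^ 2 * z ^ k * (qFactInv (p ^ 2) (a + k) * qFactInv (p ^ 2) ((b + 1 : ℕ) - k)))
      (qFactInv (p ^ 2) (a + (b + 1 : ℕ)) * (S * (1 - -(p * z) * (p ^ 2) ^ b))) := by
  have hq : ‖p ^ 2‖ < 1 := by
    rw [norm_pow]; exact pow_lt_one₀ (norm_nonneg p) hp two_ne_zero
  have hD : (1 - (p ^ 2) ^ (a + b + 1 : ℤ)) ≠ 0 := by
    exact_mod_cast one_sub_pow_ne_zero hq (Nat.succ_ne_zero (a + b))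
  have hs := (Equiv.subRight (1 : ℤ)).hasSum_iff.mpr h
  have h2 := (h.add (hs.mul_left (p ^ (2 * b + 1) * z))).mul_left
    (1 - (p ^ 2) ^ (a + b + 1 : ℤ))⁻¹
  refine h2.of_eq (fun k => ?_) ?_
  · have e1 := qFactInv_sub_one hq (a + k)
    have e2 := qFactInv_sub_one hq (b + 1 - k)
    have h1 : p ^ k ^ 2 * z ^ k * (p ^ 2) ^ (b + 1 - k) =
        p ^ (2 * b + 1) * z * (p ^ (k - 1) ^ 2 * z ^ (k - 1)) := by
      have : p ^ k ^ 2 * (p ^ 2) ^ (b + 1 - k) = p ^ (2 * b + 1) * p ^ (k - 1) ^ 2 := by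
        rw [← zpow_natCast p 2, ← zpow_mul, ← zpow_natCast p (2 * b + 1), ← zpow_add₀ hp0,
          ← zpow_add₀ hp0]
        congr 1; push_cast; ring
      rw [zpow_sub_one₀ hz]
      field_simp
      linear_combination this
    have h3 : (p ^ 2) ^ (a + b + 1 : ℤ) = (p ^ 2) ^ (b + 1 - k) * (p ^ 2) ^ (a + k) := by
      rw [← zpow_add₀ (pow_ne_zero 2 hp0)]; congr 1; ring
    rw [eq_inv_mul_iff_mul_eq₀ hD, Function.comp_apply, Equiv.subRight_apply,
      show (b : ℤ) - (k - 1) = b + 1 - k by ring, show (a : ℤ) + (k - 1) = a + k - 1 by ring,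
      show (b : ℤ) - k = b + 1 - k - 1 by ring, e1, e2, h3, Nat.cast_succ]
    linear_combination qFactInv (p ^ 2) (a + k) * qFactInv (p ^ 2) (b + 1 - k) *
      (1 - (p ^ 2) ^ (a + k)) * h1
  · have e := qFactInv_sub_one hq (a + b + 1)
    rw [add_sub_cancel_right] at e
    rw [eq_inv_mul_iff_mul_eq₀ hD, e, Nat.cast_succ, ← add_assoc]
    ring

theorem hasSum_theta_mul_qFactInv_of_zero {p : ℂ} (hp : ‖p‖ < 1) (hp0 : p ≠ 0) {z : ℂ}
    (hz : z ≠ 0) {a : ℕ} {S : ℂ}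
    (h : HasSum (fun k : ℤ =>
      p ^ k ^ 2 * z ^ k * (qFactInv (p ^ 2) (a + k) * qFactInv (p ^ 2) ((0 : ℕ) - k)))
      (qFactInv (p ^ 2) (a + (0 : ℕ)) * S)) (b : ℕ) :
    HasSum (fun k : ℤ =>
      p ^ k ^ 2 * z ^ k * (qFactInv (p ^ 2) (a + k) * qFactInv (p ^ 2) (b - k)))
      (qFactInv (p ^ 2) (a + b) * (S * qPochhammer (-(p * z)) (p ^ 2) b)) := by
  induction b with
  | zero => simpa [qPochhammer_zero] using h
  | succ b ih =>
    have := hasSum_theta_mul_qFactInv_succ hp hp0 hz ih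
    rwa [mul_assoc, ← qPochhammer_succ] at this

/-- The finite form of the Jacobi triple product identity. -/
theorem hasSum_theta_mul_qFactInv {p : ℂ} (hp : ‖p‖ < 1) (hp0 : p ≠ 0) {z : ℂ} (hz : z ≠ 0)
    (a b : ℕ) :
    HasSum (fun k : ℤ =>
      p ^ k ^ 2 * z ^ k * (qFactInv (p ^ 2) (a + k) * qFactInv (p ^ 2) (b - k)))
      (qFactInv (p ^ 2) (a + b) *
        (qPochhammer (-(p * z⁻¹)) (p ^ 2) a * qPochhammer (-(p * z)) (p ^ 2) b)) := by
  refine hasSum_theta_mul_qFactInv_of_zero hp hp0 hz ?_ b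
  have h0 : HasSum (fun k : ℤ => p ^ k ^ 2 * z⁻¹ ^ k *
      (qFactInv (p ^ 2) ((0 : ℕ) + k) * qFactInv (p ^ 2) ((0 : ℕ) - k)))
      (qFactInv (p ^ 2) ((0 : ℕ) + (0 : ℕ)) * 1) := by
    refine (hasSum_single (0 : ℤ) fun k hk => ?_).of_eq (fun _ => rfl) (by simp [qFactInv_zero])
    · rcases lt_or_gt_of_ne hk with hk | hk
      · rw [qFactInv_of_neg _ (show (((0 : ℕ) : ℤ) + k) < 0 by simpa using hk)]; ring
      · rw [qFactInv_of_neg _ (show (((0 : ℕ) : ℤ) - k) < 0 by simpa using hk)]; ring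
  -- The case `b = 0` is the same induction, now on `a`, after the symmetry `k ↦ -k`, `z ↦ z⁻¹`; it
  -- starts at `a = b = 0`, where only `k = 0` survives.
  have h1 := hasSum_theta_mul_qFactInv_of_zero hp hp0 (inv_ne_zero hz) h0 a
  have h2 := (Equiv.neg ℤ).hasSum_iff.mpr h1
  refine h2.of_eq (fun k => ?_) ?_
  · simp only [Function.comp_apply, Equiv.neg_apply, neg_sq, inv_zpow', neg_neg, sub_neg_eq_add,
      ← sub_eq_add_neg]
    ring
  · rw [add_comm, one_mul]

/-- The Jacobi triple product identity. -/
theorem hasSum_jacobi_triple_product {p : ℂ} (hp : ‖p‖ < 1) (hp0 : p ≠ 0) {z : ℂ} (hz : z ≠ 0) :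
    HasSum (fun k : ℤ => p ^ k ^ 2 * z ^ k)
      (qPochhammerInf (-(p * z⁻¹)) (p ^ 2) * qPochhammerInf (-(p * z)) (p ^ 2) *
        qPochhammerInf (p ^ 2) (p ^ 2)) := by
  have hq : ‖p ^ 2‖ < 1 := by
    rw [norm_pow]; exact pow_lt_one₀ (norm_nonneg p) hp two_ne_zero
  have hN := qPochhammerInf_self_ne_zero hq
  have hsum := summable_zpow_sq_mul_zpow hp z
  obtain ⟨C, hC0, hC⟩ := exists_norm_qFactInv_le hq
  have hR := tendsto_qFactInv hq
  have hnat : Tendsto (fun n : ℕ => (n : ℤ)) atTop atTop := tendsto_natCast_atTop_atTop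
  -- Let `n → ∞` in the finite form with `a = b = n`, the summands being dominated by `C² ‖p^{k²}
  -- z^k‖`.
  have hlim := tendsto_tsum_of_dominated_convergence (𝓕 := atTop)
    (f := fun (n : ℕ) (k : ℤ) =>
      p ^ k ^ 2 * z ^ k * (qFactInv (p ^ 2) (n + k) * qFactInv (p ^ 2) (n - k)))
    (g := fun k : ℤ => p ^ k ^ 2 * z ^ k *
      ((qPochhammerInf (p ^ 2) (p ^ 2))⁻¹ * (qPochhammerInf (p ^ 2) (p ^ 2))⁻¹))
    (hsum.norm.mul_right (C * C))
    (fun k => by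
      refine Tendsto.const_mul _ (Tendsto.mul ?_ ?_)
      · exact hR.comp (tendsto_atTop_add_const_right _ k hnat)
      · exact hR.comp (tendsto_atTop_add_const_right _ (-k) hnat))
    (Eventually.of_forall fun n k => by
      rw [norm_mul, norm_mul (qFactInv _ _)]
      gcongr <;> exact hC _)
  have hlim2 : Tendsto (fun n : ℕ => qFactInv (p ^ 2) ((n : ℤ) + n) *
      (qPochhammer (-(p * z⁻¹)) (p ^ 2) n * qPochhammer (-(p * z)) (p ^ 2) n)) atTop
      (𝓝 ((qPochhammerInf (p ^ 2) (p ^ 2))⁻¹ *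
        (qPochhammerInf (-(p * z⁻¹)) (p ^ 2) * qPochhammerInf (-(p * z)) (p ^ 2)))) :=
    (hR.comp (hnat.atTop_add_atTop hnat)).mul
      ((tendsto_qPochhammer _ hq).mul (tendsto_qPochhammer _ hq))
  have heq := tendsto_nhds_unique hlim
    (hlim2.congr fun n => (hasSum_theta_mul_qFactInv hp hp0 hz n n).tsum_eq.symm)
  rw [tsum_mul_right] at heq
  refine hsum.hasSum.of_eq (fun _ => rfl) ?_
  field_simp at heq
  rw [← div_eq_mul_inv]
  linear_combination -heq

/-- Euler's expansion of `(-p z; p²)_∞` in powers of `z`. -/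
theorem hasSum_euler {p : ℂ} (hp : ‖p‖ < 1) (hp0 : p ≠ 0) {z : ℂ} (hz : z ≠ 0) :
    HasSum (fun k : ℕ => p ^ k ^ 2 * z ^ k * qFactInv (p ^ 2) k)
      (qPochhammerInf (-(p * z)) (p ^ 2)) := by
  have hq : ‖p ^ 2‖ < 1 := by
    rw [norm_pow]; exact pow_lt_one₀ (norm_nonneg p) hp two_ne_zero
  have hN := qPochhammerInf_self_ne_zero hq
  have hsum : Summable fun k : ℤ => p ^ k ^ 2 * z ^ k * qFactInv (p ^ 2) k := by
    simpa [qFactInv_zero] using summable_mul_qFactInv_mul hq (summable_zpow_sq_mul_zpow hp z)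
      (fun k => k) (fun _ => 0)
  obtain ⟨C, hC0, hC⟩ := exists_norm_qFactInv_le hq
  have hR := tendsto_qFactInv hq
  have hnat : Tendsto (fun n : ℕ => (n : ℤ)) atTop atTop := tendsto_natCast_atTop_atTop
  -- Here `a = 0` stays fixed and `b = n → ∞`, so the factor `qFactInv (p ^ 2) k` remains and
  -- removes the negative `k`.
  have hlim := tendsto_tsum_of_dominated_convergence (𝓕 := atTop)
    (f := fun (n : ℕ) (k : ℤ) =>
      p ^ k ^ 2 * z ^ k * (qFactInv (p ^ 2) ((0 : ℕ) + k) * qFactInv (p ^ 2) (n - k)))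
    (g := fun k : ℤ => p ^ k ^ 2 * z ^ k * (qFactInv (p ^ 2) ((0 : ℕ) + k) *
      (qPochhammerInf (p ^ 2) (p ^ 2))⁻¹))
    ((summable_zpow_sq_mul_zpow hp z).norm.mul_right (C * C))
    (fun k => Tendsto.const_mul _ (Tendsto.const_mul _
      (hR.comp (tendsto_atTop_add_const_right _ (-k) hnat))))
    (Eventually.of_forall fun n k => by
      rw [norm_mul, norm_mul (qFactInv _ _)]
      gcongr <;> exact hC _)
  have hlim2 : Tendsto (fun n : ℕ => qFactInv (p ^ 2) (((0 : ℕ) : ℤ) + n) *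
      (qPochhammer (-(p * z⁻¹)) (p ^ 2) 0 * qPochhammer (-(p * z)) (p ^ 2) n)) atTop
      (𝓝 ((qPochhammerInf (p ^ 2) (p ^ 2))⁻¹ * (1 * qPochhammerInf (-(p * z)) (p ^ 2)))) := by
    rw [qPochhammer_zero]
    simpa using (hR.comp hnat).mul (tendsto_qPochhammer (-(p * z)) hq)
  have heq := tendsto_nhds_unique hlim
    (hlim2.congr fun n => (hasSum_theta_mul_qFactInv hp hp0 hz 0 n).tsum_eq.symm)
  simp_rw [Nat.cast_zero, zero_add, ← mul_assoc] at heq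
  rw [tsum_mul_right] at heq
  have h := hsum.hasSum
  have hS : ∑' k : ℤ, p ^ k ^ 2 * z ^ k * qFactInv (p ^ 2) k =
      qPochhammerInf (-(p * z)) (p ^ 2) := by
    refine mul_right_cancel₀ (inv_ne_zero hN) (heq.trans ?_)
    ring
  rw [hS, ← (Nat.cast_injective (R := ℤ)).hasSum_iff] at h
  · exact_mod_cast h
  · intro k hk
    rw [qFactInv_of_neg, mul_zero]
    by_contra hk'
    exact hk ⟨k.toNat, by simp; omega⟩

/-! ### The quintuple product identity. -/

theorem qPochhammerInf_one {q : ℂ} (hq : ‖q‖ < 1) : qPochhammerInf 1 q = 0 := by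
  refine tendsto_nhds_unique (tendsto_qPochhammer 1 hq) (tendsto_const_nhds.congr' ?_)
  filter_upwards [eventually_ge_atTop 1] with n hn
  refine (Finset.prod_eq_zero (Finset.mem_range.mpr hn) ?_).symm
  simp

theorem qPochhammerInf_trisect {q : ℂ} (hq : ‖q‖ < 1) :
    qPochhammerInf q (q ^ 3) * qPochhammerInf (q ^ 2) (q ^ 3) * qPochhammerInf (q ^ 3) (q ^ 3) =
      qPochhammerInf q q := by
  have hq3 : ‖q ^ 3‖ < 1 := by
    rw [norm_pow]; exact pow_lt_one₀ (norm_nonneg q) hq three_ne_zero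
  have hfin : ∀ n : ℕ, qPochhammer q (q ^ 3) n * qPochhammer (q ^ 2) (q ^ 3) n *
      qPochhammer (q ^ 3) (q ^ 3) n = qPochhammer q q (3 * n) := by
    intro n
    induction n with
    | zero => simp [qPochhammer_zero]
    | succ n ih =>
      rw [show 3 * (n + 1) = 3 * n + 1 + 1 + 1 by ring]
      simp only [qPochhammer_succ]
      rw [← ih]
      ring
  have h3 : Tendsto (fun n : ℕ => 3 * n) atTop atTop :=
    tendsto_atTop_mono (fun n => show n ≤ 3 * n by omega) tendsto_id
  exact tendsto_nhds_unique ((((tendsto_qPochhammer q hq3).mul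
    (tendsto_qPochhammer (q ^ 2) hq3)).mul (tendsto_qPochhammer (q ^ 3) hq3)).congr hfin)
    ((tendsto_qPochhammer q hq).comp h3)

/-- The change of variables `(s, k, n) ↦ (k + s - 2 n, n + k)` on pairs of integers. -/
noncomputable def quintupleEquiv : Fin 3 × (ℤ × ℤ) ≃ ℤ × ℤ :=
  Equiv.ofBijective (fun x => (x.2.1 + (x.1 : ℕ) - 2 * x.2.2, x.2.2 + x.2.1)) <| by
    constructor
    · rintro ⟨s, k, n⟩ ⟨s', k', n'⟩ h
      simp only [Prod.mk.injEq, Fin.ext_iff] at h ⊢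
      omega
    · rintro ⟨a, b⟩
      refine ⟨(⟨((a - b) % 3).toNat, by omega⟩, (b + (a - b) / 3, -((a - b) / 3))), ?_⟩
      simp only [Prod.mk.injEq]
      omega

theorem quintupleEquiv_apply (s : Fin 3) (k n : ℤ) :
    quintupleEquiv (s, (k, n)) = (k + (s : ℕ) - 2 * n, n + k) := rfl

/-- The inner theta sums of the quintuple product. -/
theorem hasSum_quintuple_inner {p : ℂ} (hp : ‖p‖ < 1) (hp0 : p ≠ 0) (s : Fin 3) :
    HasSum (fun n : ℤ => (p ^ 6) ^ n ^ 2 * (-(p ^ (2 - 4 * (s : ℕ) : ℤ))) ^ n)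
      (if s = 2 then 0 else qPochhammerInf (p ^ 4) (p ^ 4)) := by
  have hp6 : ‖p ^ 6‖ < 1 := by
    rw [norm_pow]; exact pow_lt_one₀ (norm_nonneg p) hp (by norm_num)
  have hp4 : ‖p ^ 4‖ < 1 := by
    rw [norm_pow]; exact pow_lt_one₀ (norm_nonneg p) hp (by norm_num)
  have hp12 : ‖p ^ 12‖ < 1 := by
    rw [norm_pow]; exact pow_lt_one₀ (norm_nonneg p) hp (by norm_num)
  have htri := qPochhammerInf_trisect hp4
  simp only [← pow_mul, Nat.reduceMul] at htri
  have h := hasSum_jacobi_triple_product hp6 (pow_ne_zero 6 hp0)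
    (neg_ne_zero.mpr (zpow_ne_zero (2 - 4 * (s : ℕ) : ℤ) hp0))
  refine h.of_eq (fun _ => rfl) ?_
  rw [inv_neg, mul_neg, mul_neg, neg_neg, neg_neg, ← zpow_neg, ← zpow_natCast p 6,
    ← zpow_add₀ hp0, ← zpow_add₀ hp0]
  fin_cases s
  · rw [if_neg (by decide)]
    norm_num
    simp only [← pow_mul, Nat.reduceMul]
    rw [← htri]
  · rw [if_neg (by decide)]
    norm_num
    simp only [← pow_mul, Nat.reduceMul]
    rw [← htri]; ring
  -- For `s = 2` one argument of the triple product is `p⁶ · p⁻⁶ = 1`, so the product vanishes.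
  · norm_num
    norm_cast
    simp only [← pow_mul, Nat.reduceMul]
    simp [qPochhammerInf_one hp12]

/-- The coordinates are chosen to decouple: `(k - 2n)² + 2(n + k)² = 3k² + 6n²` has no cross term,
and the exponent of `z` is free of `n`. The sum over `n` is then a constant for each residue `s`. -/
theorem quintuple_term {p z : ℂ} (hp0 : p ≠ 0) (hz : z ≠ 0) (s : ℕ) (k n : ℤ) :
    p ^ (k + s - 2 * n) ^ 2 * (-(z / p)) ^ (k + s - 2 * n) *
        ((p ^ 2) ^ (n + k) ^ 2 * (-z ^ 2) ^ (n + k)) =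
      (-1) ^ s * p ^ (3 * k ^ 2 - k + 2 * k * s + (s ^ 2 - s) : ℤ) * z ^ (3 * k + s) *
        ((p ^ 6) ^ n ^ 2 * (-(p ^ (2 - 4 * s : ℤ))) ^ n) := by
  have e1 : ∀ m : ℤ, (-(z / p)) ^ m = (-1) ^ m * z ^ m * p ^ (-m) := fun m => by
    rw [neg_eq_neg_one_mul, mul_zpow, div_zpow, zpow_neg]; ring
  have e2 : ∀ m : ℤ, (-z ^ 2) ^ m = (-1) ^ m * z ^ (2 * m) := fun m => by
    rw [neg_eq_neg_one_mul, mul_zpow, zpow_mul]; rfl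
  have e3 : (-(p ^ (2 - 4 * s : ℤ))) ^ n = (-1) ^ n * p ^ ((2 - 4 * s : ℤ) * n) := by
    rw [neg_eq_neg_one_mul, mul_zpow, ← zpow_mul]
  have e4 : (-1 : ℂ) ^ (k + s - 2 * n) * (-1) ^ (n + k) = (-1) ^ s * (-1) ^ n := by
    rw [← zpow_natCast, ← zpow_add₀ (by norm_num), ← zpow_add₀ (by norm_num),
      show (k + s - 2 * n + (n + k) : ℤ) = s + n + 2 * (k - n) by ring, zpow_add₀ (by norm_num),
      zpow_mul]
    norm_num
  have e5 : z ^ (k + s - 2 * n) * z ^ (2 * (n + k)) = z ^ (3 * k + s) := by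
    rw [← zpow_add₀ hz]; congr 1; ring
  have e6 : p ^ (k + s - 2 * n) ^ 2 * p ^ (-(k + s - 2 * n)) * (p ^ 2) ^ (n + k) ^ 2 =
      p ^ (3 * k ^ 2 - k + 2 * k * s + (s ^ 2 - s) : ℤ) * (p ^ 6) ^ n ^ 2 *
        p ^ ((2 - 4 * s : ℤ) * n) := by
    rw [← zpow_natCast p 2, ← zpow_natCast p 6, ← zpow_mul, ← zpow_mul]
    simp only [← zpow_add₀ hp0]
    congr 1; push_cast; ring
  rw [e1, e2, e3]
  linear_combination (p ^ (k + s - 2 * n) ^ 2 * p ^ (-(k + s - 2 * n)) * (p ^ 2) ^ (n + k) ^ 2) *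
    (z ^ (k + s - 2 * n) * z ^ (2 * (n + k))) * e4 +
    (p ^ (k + s - 2 * n) ^ 2 * p ^ (-(k + s - 2 * n)) * (p ^ 2) ^ (n + k) ^ 2) *
    ((-1) ^ s * (-1) ^ n) * e5 + (z ^ (3 * k + s)) * ((-1) ^ s * (-1) ^ n) * e6

theorem summable_quintuple_outer {p z : ℂ} (hp : ‖p‖ < 1) (hp0 : p ≠ 0) (hz : z ≠ 0) (s : ℕ) :
    Summable fun k : ℤ =>
      (-1) ^ s * p ^ (3 * k ^ 2 - k + 2 * k * s + (s ^ 2 - s) : ℤ) * z ^ (3 * k + s) := by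
  have hp3 : ‖p ^ 3‖ < 1 := by
    rw [norm_pow]; exact pow_lt_one₀ (norm_nonneg p) hp (by norm_num)
  have h := (summable_zpow_sq_mul_zpow hp3 (p ^ (-1 + 2 * s : ℤ) * z ^ 3)).mul_left
    ((-1) ^ s * p ^ (s ^ 2 - s : ℤ) * z ^ s)
  refine h.congr fun k => ?_
  have e1 : p ^ (3 * k ^ 2 - k + 2 * k * s + (s ^ 2 - s) : ℤ) =
      (p ^ 3) ^ k ^ 2 * (p ^ (-1 + 2 * s : ℤ)) ^ k * p ^ (s ^ 2 - s : ℤ) := by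
    rw [← zpow_natCast p 3, ← zpow_mul, ← zpow_mul, ← zpow_add₀ hp0, ← zpow_add₀ hp0]
    congr 1; push_cast; ring
  have e2 : z ^ (3 * k + s) = (z ^ 3) ^ k * z ^ s := by
    rw [zpow_add₀ hz, zpow_mul]; norm_cast
  rw [e1, e2, mul_zpow]
  ring

/-- The quintuple product identity. -/
theorem hasSum_quintuple_product {p : ℂ} (hp : ‖p‖ < 1) (hp0 : p ≠ 0) {z : ℂ} (hz : z ≠ 0) :
    HasSum (fun k : ℤ =>
        p ^ (3 * k ^ 2 - k) * z ^ (3 * k) - p ^ (3 * k ^ 2 + k) * z ^ (3 * k + 1))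
      (qPochhammerInf z (p ^ 2) * qPochhammerInf (p ^ 2 / z) (p ^ 2) *
        qPochhammerInf (p ^ 2) (p ^ 2) *
        (qPochhammerInf (p ^ 2 * z ^ 2) (p ^ 4) * qPochhammerInf (p ^ 2 / z ^ 2) (p ^ 4))) := by
  have hp2 : ‖p ^ 2‖ < 1 := by
    rw [norm_pow]; exact pow_lt_one₀ (norm_nonneg p) hp (by norm_num)
  have hp4 : ‖p ^ 4‖ < 1 := by
    rw [norm_pow]; exact pow_lt_one₀ (norm_nonneg p) hp (by norm_num)
  have hN := qPochhammerInf_self_ne_zero hp4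
  -- The product of these two triple products is the desired product times `(p⁴;p⁴)_∞`, the very
  -- constant given by the inner sums for `s = 0, 1`.
  have hA := hasSum_jacobi_triple_product hp hp0 (neg_ne_zero.mpr (div_ne_zero hz hp0))
  have hB := hasSum_jacobi_triple_product hp2 (pow_ne_zero 2 hp0)
    (neg_ne_zero.mpr (pow_ne_zero 2 hz))
  rw [show -(p * -(z / p)) = z by field_simp, show -(p * (-(z / p))⁻¹) = p ^ 2 / z by
    rw [inv_neg]; field_simp] at hA
  rw [show -(p ^ 2 * -z ^ 2) = p ^ 2 * z ^ 2 by ring, show -(p ^ 2 * (-z ^ 2)⁻¹) = p ^ 2 / z ^ 2 by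
    rw [inv_neg]; field_simp, ← pow_mul] at hB
  have hAB := hA.mul_prod hB
  have hE := quintupleEquiv.hasSum_iff.mpr hAB
  have hK := summable_quintuple_outer hp hp0 hz
  have hI := hasSum_quintuple_inner hp hp0
  have hinner : ∀ s : Fin 3, HasSum
      (fun x : ℤ × ℤ => p ^ (quintupleEquiv (s, x)).1 ^ 2 * (-(z / p)) ^ (quintupleEquiv (s, x)).1 *
        ((p ^ 2) ^ (quintupleEquiv (s, x)).2 ^ 2 * (-z ^ 2) ^ (quintupleEquiv (s, x)).2))
      ((∑' k : ℤ, (-1) ^ (s : ℕ) * p ^ (3 * k ^ 2 - k + 2 * k * (s : ℕ) +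
        (((s : ℕ) : ℤ) ^ 2 - ((s : ℕ) : ℤ))) * z ^ (3 * k + ((s : ℕ) : ℤ))) *
        if s = 2 then 0 else qPochhammerInf (p ^ 4) (p ^ 4)) := fun s =>
    ((hK s).hasSum.mul_prod (hI s)).of_eq
      (fun x => by rw [quintupleEquiv_apply]; exact quintuple_term hp0 hz s x.1 x.2) rfl
  have hfib := HasSum.prod_fiberwise hE hinner
  have huniq := hfib.unique (hasSum_fintype _)
  rw [Fin.sum_univ_three, if_neg (by decide), if_neg (by decide), if_pos rfl] at huniq
  refine ((hK 0).hasSum.add (hK 1).hasSum).of_eq (fun k => ?_) ?_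
  · simp only [pow_zero, pow_one, Nat.cast_zero, Nat.cast_one]
    rw [show 3 * k ^ 2 - k + 2 * k * 0 + (0 ^ 2 - 0) = 3 * k ^ 2 - k by ring,
      show 3 * k ^ 2 - k + 2 * k * 1 + (1 ^ 2 - 1) = 3 * k ^ 2 + k by ring, add_zero]
    ring
  · refine mul_right_cancel₀ hN ?_
    simp only [Fin.val_zero, Fin.val_one] at huniq
    linear_combination huniq

/-! ### Durfee rectangles and the limiting Bailey lemma. -/

/-- The summand of Durfee's rectangle identity. -/
noncomputable def durfeeTerm (q : ℂ) (k : ℕ) (m : ℤ) : ℂ :=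
  q ^ (m ^ 2 + m * k) * (qFactInv q m * qFactInv q (m + k))

theorem durfeeTerm_of_neg (q : ℂ) (k : ℕ) {m : ℤ} (hm : m < 0) : durfeeTerm q k m = 0 := by
  rw [durfeeTerm, qFactInv_of_neg q hm]; ring

theorem summable_durfeeTerm {q : ℂ} (hq : ‖q‖ < 1) (hq0 : q ≠ 0) (k : ℕ) :
    Summable (durfeeTerm q k) := by
  refine summable_mul_qFactInv_mul hq ?_ _ _
  refine (summable_zpow_quadratic hq hq0 one_ne_zero k 0).congr fun m => ?_
  congr 1; push_cast; ring

/-- Summed over `m`, this becomes `F k - F (k+1) = q^{k+1} (F (k+2) - F (k+1))`, which forces the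
sum `F k` to be independent of `k`. -/
theorem durfeeTerm_sub {q : ℂ} (hq : ‖q‖ < 1) (hq0 : q ≠ 0) (k : ℕ) (m : ℤ) :
    durfeeTerm q k m - durfeeTerm q (k + 1) m =
      q ^ (k + 1) * (durfeeTerm q (k + 2) (m - 1) - durfeeTerm q (k + 1) m) := by
  unfold durfeeTerm
  have e1 := qFactInv_sub_one hq m
  have e2 := qFactInv_sub_one hq (m + k + 1)
  rw [add_sub_cancel_right] at e2
  rw [e1, e2, show m - 1 + ((k + 2 : ℕ) : ℤ) = m + k + 1 by push_cast; ring,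
    show m + ((k + 1 : ℕ) : ℤ) = m + k + 1 by push_cast; ring,
    show m ^ 2 + m * ((k + 1 : ℕ) : ℤ) = m ^ 2 + m * k + m by push_cast; ring,
    show (m - 1) ^ 2 + (m - 1) * ((k + 2 : ℕ) : ℤ) = m ^ 2 + m * k - (k + 1 : ℕ) by
      push_cast; ring,
    zpow_sub₀ hq0, zpow_add₀ hq0 (m ^ 2 + m * k), add_assoc m, ← Nat.cast_succ, zpow_add₀ hq0 m,
    zpow_natCast]
  have := pow_ne_zero (k + 1) hq0
  field_simp
  ring

/-- As `k → ∞` the factor `q^{mk}` kills every `m > 0`, leaving only `m = 0`. -/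
theorem tendsto_tsum_durfeeTerm {q : ℂ} (hq : ‖q‖ < 1) (hq0 : q ≠ 0) :
    Tendsto (fun k => ∑' m, durfeeTerm q k m) atTop (𝓝 (qPochhammerInf q q)⁻¹) := by
  obtain ⟨C, hC0, hC⟩ := exists_norm_qFactInv_le hq
  have hsum : Summable fun m : ℤ => q ^ m ^ 2 := by
    simpa using summable_zpow_quadratic hq hq0 one_ne_zero 0 0
  have key : ∀ (k : ℕ) (m : ℤ), 0 ≤ m →
      ‖durfeeTerm q k m‖ ≤ ‖q ^ m ^ 2‖ * (‖q‖ ^ k) ^ m.toNat * (C * C) := by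
    intro k m hm
    obtain ⟨n, rfl⟩ := Int.eq_ofNat_of_zero_le hm
    rw [durfeeTerm, zpow_add₀ hq0, norm_mul, norm_mul, norm_mul (qFactInv _ _), mul_comm (n : ℤ),
      zpow_mul, zpow_natCast, zpow_natCast, Int.toNat_natCast, norm_pow (q ^ k), norm_pow q k]
    gcongr <;> exact hC _
  have h := tendsto_tsum_of_dominated_convergence (𝓕 := atTop) (f := durfeeTerm q)
    (g := fun m : ℤ => if m = 0 then (qPochhammerInf q q)⁻¹ else 0)
    (hsum.norm.mul_right (C * C)) (fun m => ?_) (Eventually.of_forall fun k m => ?_)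
  · simpa using h
  · rcases lt_trichotomy m 0 with hm | rfl | hm
    · simp [durfeeTerm_of_neg q _ hm, hm.ne]
    · simpa [durfeeTerm, qFactInv_zero, Function.comp_def] using
        (tendsto_qFactInv hq).comp tendsto_natCast_atTop_atTop
    · rw [if_neg hm.ne']
      refine squeeze_zero_norm (fun k => key k m hm.le) ?_
      have h1 : Tendsto (fun k : ℕ => (‖q‖ ^ k) ^ m.toNat) atTop (𝓝 0) := by
        have := (tendsto_pow_atTop_nhds_zero_of_lt_one (norm_nonneg q) hq).pow m.toNat
        rwa [zero_pow (by omega)] at this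
      simpa using (h1.const_mul ‖q ^ m ^ 2‖).mul_const (C * C)
  · rcases lt_or_ge m 0 with hm | hm
    · rw [durfeeTerm_of_neg q _ hm, norm_zero]; positivity
    · refine (key k m hm).trans ?_
      gcongr
      refine mul_le_of_le_one_right (norm_nonneg _) (pow_le_one₀ (by positivity) ?_)
      exact pow_le_one₀ (norm_nonneg q) hq.le

/-- Durfee's rectangle identity. -/
theorem tsum_durfeeTerm {q : ℂ} (hq : ‖q‖ < 1) (hq0 : q ≠ 0) (k : ℕ) :
    ∑' m, durfeeTerm q k m = (qPochhammerInf q q)⁻¹ := by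
  have hlim := tendsto_tsum_durfeeTerm hq hq0
  set F : ℕ → ℂ := fun k => ∑' m, durfeeTerm q k m with hF
  have hH : ∀ k, HasSum (durfeeTerm q k) (F k) := fun k => (summable_durfeeTerm hq hq0 k).hasSum
  have hrec : ∀ k, F k - F (k + 1) = q ^ (k + 1) * (F (k + 2) - F (k + 1)) := by
    intro k
    have h1 := ((Equiv.subRight (1 : ℤ)).hasSum_iff.mpr (hH (k + 2))).sub (hH (k + 1))
    have h2 := (h1.mul_left (q ^ (k + 1))).of_eq (durfeeTerm_sub hq hq0 k) rfl
    exact ((hH k).sub (hH (k + 1))).unique h2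
  -- Since `‖q^{k+1}‖ ≤ 1`, the successive differences are nondecreasing in norm; as they also tend
  -- to zero, they all vanish.
  have hle : ∀ k, ‖F k - F (k + 1)‖ ≤ ‖F (k + 1) - F (k + 2)‖ := by
    intro k
    rw [hrec k, norm_mul, norm_sub_rev (F (k + 2)), norm_pow]
    exact mul_le_of_le_one_left (norm_nonneg _) (pow_le_one₀ (norm_nonneg q) hq.le)
  have hmono : Monotone fun k => ‖F k - F (k + 1)‖ := monotone_nat_of_le_succ hle
  have hd : Tendsto (fun k => ‖F k - F (k + 1)‖) atTop (𝓝 0) := by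
    simpa using (hlim.sub (hlim.comp (tendsto_add_atTop_nat 1))).norm
  have hzero : ∀ k, F (k + 1) = F k := fun k => by
    have := norm_le_zero_iff.mp (hmono.ge_of_tendsto hd k)
    exact (sub_eq_zero.mp this).symm
  have hconst : ∀ n, F n = F 0 := fun n => by
    induction n with
    | zero => rfl
    | succ n ih => rw [hzero, ih]
  have : F 0 = (qPochhammerInf q q)⁻¹ :=
    tendsto_nhds_unique tendsto_const_nhds (hlim.congr hconst)
  exact (hconst k).trans this

/-- This is Durfee's identity with `m = n - s` and rectangle excess `k = 2s + ε`. The symmetry `s ↦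
-s - ε` allows `k ≥ 0` to be assumed. -/
theorem hasSum_durfee {q : ℂ} (hq : ‖q‖ < 1) (hq0 : q ≠ 0) {ε : ℕ} (hε : ε ≤ 1) (s : ℤ) :
    HasSum (fun n : ℕ => q ^ (n ^ 2 + ε * n) * (qFactInv q (n - s) * qFactInv q (n + s + ε)))
      (q ^ (s ^ 2 + ε * s) * (qPochhammerInf q q)⁻¹) := by
  wlog hs : 0 ≤ 2 * s + ε generalizing s
  · refine (this (-s - ε) (by omega)).of_eq (fun n => ?_) ?_
    · rw [show (n : ℤ) - (-s - ε) = n + s + ε by ring,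
        show (n : ℤ) + (-s - ε) + ε = n - s by ring]
      ring
    · rw [show (-s - ε) ^ 2 + ε * (-s - ε) = s ^ 2 + ε * s by ring]
  obtain ⟨k, hk⟩ := Int.eq_ofNat_of_zero_le hs
  have h := (summable_durfeeTerm hq hq0 k).hasSum
  rw [tsum_durfeeTerm hq hq0] at h
  have h2 := ((Equiv.subRight s).hasSum_iff.mpr h).mul_left (q ^ (s ^ 2 + ε * s))
  have h3 : HasSum (fun n : ℤ => q ^ (n ^ 2 + ε * n) *
      (qFactInv q (n - s) * qFactInv q (n + s + ε)))
      (q ^ (s ^ 2 + ε * s) * (qPochhammerInf q q)⁻¹) := by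
    refine h2.of_eq (fun n => ?_) rfl
    rw [Function.comp_apply, Equiv.subRight_apply, durfeeTerm, ← mul_assoc (q ^ _) (q ^ _), ← zpow_add₀ hq0,
      show n - s + (k : ℤ) = n + s + ε by omega,
      show s ^ 2 + ε * s + ((n - s) ^ 2 + (n - s) * k) = n ^ 2 + ε * n by
        rw [show (k : ℤ) = 2 * s + ε from hk.symm]; ring]
  rw [← (Nat.cast_injective (R := ℤ)).hasSum_iff] at h3
  · exact h3
  · intro n hn
    have hn' : n < 0 := by
      by_contra hn'
      exact hn ⟨n.toNat, by simp; omega⟩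
    -- If `s ≤ n < 0`, then `n + s + ε ≤ ε - 2 < 0`, so one reciprocal factorial always vanishes.
    rcases lt_or_ge (n - s) 0 with h | h
    · rw [qFactInv_of_neg q h]; ring
    · rw [qFactInv_of_neg q (show n + s + ε < 0 by omega)]; ring

/-- The limiting case of Bailey's lemma. -/
theorem hasSum_bailey {q : ℂ} (hq : ‖q‖ < 1) (hq0 : q ≠ 0) {ε : ℕ} (hε : ε ≤ 1)
    {α : ℤ → ℂ} (hα : Summable α) (s : ℤ → ℤ) {b : ℕ → ℂ}
    (hb : ∀ n : ℕ, HasSum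
      (fun r => α r * (qFactInv q (n - s r) * qFactInv q (n + s r + ε))) (b n)) :
    HasSum (fun n : ℕ => q ^ (n ^ 2 + ε * n) * b n)
      ((qPochhammerInf q q)⁻¹ * ∑' r, α r * q ^ (s r ^ 2 + ε * s r)) ∧
    Summable fun r => α r * q ^ (s r ^ 2 + ε * s r) := by
  have hn : Summable fun n : ℕ => q ^ (n ^ 2 + ε * n) := by
    have h := (summable_pow_sq_mul_pow hq (q ^ ε))
    refine h.congr fun n => ?_
    rw [pow_add, pow_mul]
  -- The double family is absolutely summable: summing over `r` first gives `b n`, while summing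
  -- over `n` first applies Durfee's identity.
  have hG := summable_mul_qFactInv_mul hq (hn.hasSum.mul_prod hα.hasSum).summable
    (fun x => x.1 - s x.2) (fun x => x.1 + s x.2 + ε)
  have h1 := HasSum.prod_fiberwise hG.hasSum (g := fun n : ℕ => q ^ (n ^ 2 + ε * n) * b n)
    fun n => ((hb n).mul_left (q ^ (n ^ 2 + ε * n))).of_eq (fun r => by ring) rfl
  have h2 := HasSum.prod_fiberwise ((Equiv.prodComm ℤ ℕ).hasSum_iff.mpr hG.hasSum)
    (g := fun r => α r * (q ^ (s r ^ 2 + ε * s r) * (qPochhammerInf q q)⁻¹))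
    fun r => ((hasSum_durfee hq hq0 hε (s r)).mul_left (α r)).of_eq (fun n => by
      simp only [Function.comp_apply, Equiv.prodComm_apply, Prod.swap_prod_mk]
      ring) rfl
  have h3 := (h2.mul_right (qPochhammerInf q q)).of_eq
    (f := fun r => α r * q ^ (s r ^ 2 + ε * s r)) (fun r => by
      have := qPochhammerInf_self_ne_zero hq
      field_simp) rfl
  refine ⟨h1.of_eq (fun _ => rfl) ?_, h3.summable⟩
  rw [h3.tsum_eq]
  have := qPochhammerInf_self_ne_zero hq
  field_simp

/-! ### Schur-type finite identities. -/

/-- The sum `∑_r q^{6r² + br + d} / ((q; q)_{x - 3r} (q; q)_{y + 3r})` over the integers. -/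
noncomputable def schurSum (q : ℂ) (b d x y : ℤ) : ℂ :=
  ∑' r : ℤ, q ^ (6 * r ^ 2 + b * r + d) * (qFactInv q (x - 3 * r) * qFactInv q (y + 3 * r))

theorem hasSum_schurSum {q : ℂ} (hq : ‖q‖ < 1) (hq0 : q ≠ 0) (b d x y : ℤ) :
    HasSum (fun r : ℤ => q ^ (6 * r ^ 2 + b * r + d) *
      (qFactInv q (x - 3 * r) * qFactInv q (y + 3 * r))) (schurSum q b d x y) :=
  (summable_mul_qFactInv_mul hq
    (summable_zpow_quadratic hq hq0 (a := 6) (by norm_num) b d) _ _).hasSum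

theorem schurSum_reflect (q : ℂ) (b d x y : ℤ) :
    schurSum q b d x y = schurSum q (-b) d y x := by
  unfold schurSum
  rw [← (Equiv.neg ℤ).tsum_eq]
  refine tsum_congr fun r => ?_
  rw [Equiv.neg_apply, show x - 3 * -r = x + 3 * r by ring, show y + 3 * -r = y - 3 * r by ring,
    show 6 * (-r) ^ 2 + b * -r + d = 6 * r ^ 2 + -b * r + d by ring, mul_comm (qFactInv q _)]

theorem schurSum_shift (q : ℂ) (b d x y : ℤ) :
    schurSum q b d x y = schurSum q (b + 12) (b + d + 6) (x - 3) (y + 3) := by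
  unfold schurSum
  rw [← (Equiv.addRight (1 : ℤ)).tsum_eq]
  refine tsum_congr fun r => ?_
  rw [Equiv.coe_addRight]
  congr 2
  · ring
  · congr 1; ring
  · congr 1; ring

theorem zpow_mul_schurSum {q : ℂ} (hq0 : q ≠ 0) (e b d x y : ℤ) :
    q ^ e * schurSum q b d x y = schurSum q b (d + e) x y := by
  unfold schurSum
  rw [← tsum_mul_left]
  refine tsum_congr fun r => ?_
  rw [← mul_assoc, ← zpow_add₀ hq0]
  congr 2; ring

/-- Termwise `q`-Pascal: `1 - q^{X+Y} = (1 - q^X) + q^X (1 - q^Y)` with `X = x - 3r`, `Y = y + 3r`.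
-/
theorem schurSum_pascal_left {q : ℂ} (hq : ‖q‖ < 1) (hq0 : q ≠ 0) (b d x y : ℤ) :
    (1 - q ^ (x + y)) * schurSum q b d x y =
      schurSum q b d (x - 1) y + schurSum q (b - 3) (d + x) x (y - 1) := by
  refine ((hasSum_schurSum hq hq0 b d x y).mul_left _).unique
    (((hasSum_schurSum hq hq0 b d (x - 1) y).add
      (hasSum_schurSum hq hq0 (b - 3) (d + x) x (y - 1))).of_eq (fun r => ?_) rfl)
  have e1 := qFactInv_sub_one hq (x - 3 * r)
  have e2 := qFactInv_sub_one hq (y + 3 * r)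
  rw [show x - 1 - 3 * r = x - 3 * r - 1 by ring, show y - 1 + 3 * r = y + 3 * r - 1 by ring, e1,
    e2, show 6 * r ^ 2 + (b - 3) * r + (d + x) = 6 * r ^ 2 + b * r + d + (x - 3 * r) by ring,
    zpow_add₀ hq0 _ (x - 3 * r), show x + y = (x - 3 * r) + (y + 3 * r) by ring,
    zpow_add₀ hq0 (x - 3 * r)]
  ring

theorem schurSum_pascal_right {q : ℂ} (hq : ‖q‖ < 1) (hq0 : q ≠ 0) (b d x y : ℤ) :
    (1 - q ^ (x + y)) * schurSum q b d x y =
      schurSum q b d x (y - 1) + schurSum q (b + 3) (d + y) (x - 1) y := by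
  have h := schurSum_pascal_left hq hq0 (-b) d y x
  rw [schurSum_reflect q (-b), schurSum_reflect q (-b), schurSum_reflect q (-b - 3), neg_neg,
    add_comm y] at h
  rw [h]
  congr 2
  ring

theorem schurSum_zero_zero (q : ℂ) (b : ℤ) : schurSum q b 0 0 0 = 1 := by
  unfold schurSum
  rw [tsum_eq_single 0]
  · simp [qFactInv_zero]
  · intro r hr
    rcases lt_or_gt_of_ne hr with hr | hr
    · rw [qFactInv_of_neg q (show 0 + 3 * r < 0 by omega)]; ring
    · rw [qFactInv_of_neg q (show 0 - 3 * r < 0 by omega)]; ring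

theorem schurSum_neg_one_one (q : ℂ) (b d : ℤ) : schurSum q b d (-1) 1 = 0 := by
  unfold schurSum
  rw [← tsum_zero (β := ℤ)]
  refine tsum_congr fun r => ?_
  rcases lt_or_ge r 0 with hr | hr
  · rw [qFactInv_of_neg q (show 1 + 3 * r < 0 by omega)]; ring
  · rw [qFactInv_of_neg q (show -1 - 3 * r < 0 by omega)]; ring

theorem one_sub_zpow_mul_qFactInv {q : ℂ} (hq : ‖q‖ < 1) (n : ℤ) :
    (1 - q ^ (n + 1)) * qFactInv q (n + 1) = qFactInv q n := by
  rw [← qFactInv_sub_one hq, add_sub_cancel_right]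

theorem one_sub_zpow_ne_zero {q : ℂ} (hq : ‖q‖ < 1) {n : ℤ} (hn : 0 < n) : 1 - q ^ n ≠ 0 := by
  obtain ⟨m, rfl⟩ := Int.eq_ofNat_of_zero_le hn.le
  exact_mod_cast one_sub_pow_ne_zero hq (n := m) (by omega)

/-- After one Pascal step on each sum, the leading terms form the even identity, and the two
remainders agree by reflection and shift. -/
theorem schurSum_odd_of_even {q : ℂ} (hq : ‖q‖ < 1) (hq0 : q ≠ 0) {n : ℤ} (hn : 0 ≤ n)
    (h : schurSum q 1 0 n n - schurSum q 5 1 (n - 1) (n + 1) = qFactInv q (2 * n)) :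
    schurSum q 1 0 n (n + 1) - schurSum q 5 1 (n - 1) (n + 2) = qFactInv q (2 * n + 1) := by
  have h1 := schurSum_pascal_right hq hq0 1 0 n (n + 1)
  have h2 := schurSum_pascal_right hq hq0 5 1 (n - 1) (n + 2)
  have h3 := schurSum_shift q (-8) (n + 3) (n + 2) (n - 2)
  rw [← neg_neg (8 : ℤ), ← schurSum_reflect] at h3
  have h4 := one_sub_zpow_mul_qFactInv hq (2 * n)
  refine mul_left_cancel₀ (one_sub_zpow_ne_zero hq (show 0 < 2 * n + 1 by omega)) ?_
  ring_nf at h h1 h2 h3 h4 ⊢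
  linear_combination h + h1 - h2 - h3 - h4

theorem schurSum_even_of_odd {q : ℂ} (hq : ‖q‖ < 1) (hq0 : q ≠ 0) {n : ℤ} (hn : 0 ≤ n)
    (h : schurSum q 1 0 n (n + 1) - schurSum q 5 1 (n - 1) (n + 2) = qFactInv q (2 * n + 1)) :
    schurSum q 1 0 (n + 1) (n + 1) - schurSum q 5 1 n (n + 2) = qFactInv q (2 * n + 2) := by
  have h1 := schurSum_pascal_left hq hq0 1 0 (n + 1) (n + 1)
  have h2 := schurSum_pascal_left hq hq0 5 1 n (n + 2)
  have h3 := schurSum_reflect q 2 (n + 1) n (n + 1)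
  have h4 := one_sub_zpow_mul_qFactInv hq (2 * n + 1)
  refine mul_left_cancel₀ (one_sub_zpow_ne_zero hq (show 0 < 2 * n + 2 by omega)) ?_
  ring_nf at h h1 h2 h3 h4 ⊢
  linear_combination h + h1 - h2 - h3 - h4

/-- Schur's finite identity `∑_j (-1)^j q^{j(3j+1)/2} [2n, ⌊n - 3j/2⌋] = 1`. -/
theorem schurSum_even {q : ℂ} (hq : ‖q‖ < 1) (hq0 : q ≠ 0) (n : ℕ) :
    schurSum q 1 0 n n - schurSum q 5 1 (n - 1) (n + 1) = qFactInv q (2 * n) := by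
  induction n with
  | zero => simp [schurSum_zero_zero, schurSum_neg_one_one, qFactInv_zero]
  | succ n ih =>
    have h := schurSum_even_of_odd hq hq0 (Int.natCast_nonneg n)
      (schurSum_odd_of_even hq hq0 (Int.natCast_nonneg n) ih)
    rw [Nat.cast_succ, add_sub_cancel_right, mul_add, mul_one, add_assoc]
    exact h

theorem schurSum_odd {q : ℂ} (hq : ‖q‖ < 1) (hq0 : q ≠ 0) (n : ℕ) :
    schurSum q 1 0 n (n + 1) - schurSum q 5 1 (n - 1) (n + 2) = qFactInv q (2 * n + 1) :=
  schurSum_odd_of_even hq hq0 (Int.natCast_nonneg n) (schurSum_even hq hq0 n)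

/-- Here the roles are reversed: the leading Pascal terms coincide and cancel, while the remainders
form `q^{n+1}` times the odd identity one level below. -/
theorem schurSum_even' (hq : ‖q‖ < 1) (hq0 : q ≠ 0) (n : ℕ) :
    schurSum q 2 0 n n - schurSum q 2 0 (n - 1) (n + 1) = q ^ n * qFactInv q (2 * n) := by
  cases n with
  | zero => simp [schurSum_zero_zero, schurSum_neg_one_one, qFactInv_zero]
  | succ n =>
    have h := schurSum_odd hq hq0 n
    have h1 := schurSum_pascal_left hq hq0 2 0 (n + 1) (n + 1)
    have h2 := schurSum_pascal_right hq hq0 2 0 n (n + 2)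
    have h3 := schurSum_reflect q (-1) (n + 1) (n + 1) n
    have h4 := one_sub_zpow_mul_qFactInv hq (2 * n + 1)
    have h5 := zpow_mul_schurSum hq0 (n + 1) 1 0 n (n + 1)
    have h6 := zpow_mul_schurSum hq0 (n + 1) 5 1 (n - 1) (n + 2)
    refine mul_left_cancel₀ (one_sub_zpow_ne_zero hq (show 0 < 2 * (n : ℤ) + 2 by omega)) ?_
    rw [← zpow_natCast]
    push_cast
    generalize (n : ℤ) = m at *
    generalize hE : q ^ (m + 1) = E at *
    ring_nf at h h1 h2 h3 h4 h5 h6 ⊢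
    linear_combination h1 - h2 + h3 - h5 + h6 + E * h - E * h4

theorem schurSum_odd' (hq : ‖q‖ < 1) (hq0 : q ≠ 0) (n : ℕ) :
    schurSum q 4 0 n (n + 1) - schurSum q 4 0 (n - 1) (n + 2) =
      q ^ n * qFactInv q (2 * n + 1) := by
  have h := schurSum_even hq hq0 n
  have h1 := schurSum_pascal_left hq hq0 4 0 n (n + 1)
  have h2 := schurSum_pascal_right hq hq0 4 0 (n - 1) (n + 2)
  have h3 := schurSum_shift q (-7) (n + 2) (n + 2) (n - 2)
  rw [← neg_neg (7 : ℤ), ← schurSum_reflect] at h3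
  have h4 := one_sub_zpow_mul_qFactInv hq (2 * n)
  have h5 := zpow_mul_schurSum hq0 n 1 0 n n
  have h6 := zpow_mul_schurSum hq0 n 5 1 (n - 1) (n + 1)
  refine mul_left_cancel₀ (one_sub_zpow_ne_zero hq (show 0 < 2 * (n : ℤ) + 1 by omega)) ?_
  rw [← zpow_natCast]
  generalize (n : ℤ) = m at *
  generalize hE : q ^ m = E at *
  ring_nf at h h1 h2 h3 h4 h5 h6 ⊢
  linear_combination h1 - h2 - h3 - h5 + h6 + E * h - E * h4

/-! ### Theta differences and the single Rogers–Slater series. -/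

/-- The theta series `∑_r q^{15r² + br + d}` over the integers. -/
noncomputable def thetaSum (q : ℂ) (b d : ℤ) : ℂ := ∑' r : ℤ, q ^ (15 * r ^ 2 + b * r + d)

theorem hasSum_thetaSum {q : ℂ} (hq : ‖q‖ < 1) (hq0 : q ≠ 0) (b d : ℤ) :
    HasSum (fun r : ℤ => q ^ (15 * r ^ 2 + b * r + d)) (thetaSum q b d) :=
  (summable_zpow_quadratic hq hq0 (a := 15) (by norm_num) b d).hasSum

theorem thetaSum_reflect (q : ℂ) (b d : ℤ) : thetaSum q b d = thetaSum q (-b) d := by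
  unfold thetaSum
  rw [← (Equiv.neg ℤ).tsum_eq]
  refine tsum_congr fun r => ?_
  rw [Equiv.neg_apply]
  congr 1; ring

theorem thetaSum_shift (q : ℂ) (b d : ℤ) :
    thetaSum q b d = thetaSum q (b + 30) (b + d + 15) := by
  unfold thetaSum
  rw [← (Equiv.addRight (1 : ℤ)).tsum_eq]
  refine tsum_congr fun r => ?_
  rw [Equiv.coe_addRight]
  congr 1; ring

/-- The quintuple product at `p = q⁵`, `z = q^c`; the bound on `c` keeps the exponent `10 - 2c` a
natural number. -/
theorem thetaSum_sub_thetaSum {q : ℂ} (hq : ‖q‖ < 1) (hq0 : q ≠ 0) {c : ℕ} (hc : c ≤ 5) :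
    thetaSum q (3 * c - 5) 0 - thetaSum q (3 * c + 5) c =
      qPochhammerInf (q ^ c) (q ^ 10) * qPochhammerInf (q ^ (10 - c)) (q ^ 10) *
        qPochhammerInf (q ^ 10) (q ^ 10) *
        (qPochhammerInf (q ^ (10 + 2 * c)) (q ^ 20) *
          qPochhammerInf (q ^ (10 - 2 * c)) (q ^ 20)) := by
  have hp : ‖q ^ 5‖ < 1 := by
    rw [norm_pow]; exact pow_lt_one₀ (norm_nonneg q) hq (by norm_num)
  have h := hasSum_quintuple_product hp (pow_ne_zero 5 hq0) (pow_ne_zero c hq0)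
  simp only [← pow_mul, ← pow_add, Nat.reduceMul] at h
  rw [div_eq_mul_inv, div_eq_mul_inv, ← pow_sub₀ q hq0 (show c ≤ 10 by omega),
    ← pow_sub₀ q hq0 (show c * 2 ≤ 10 by omega), mul_comm c 2] at h
  refine ((hasSum_thetaSum hq hq0 _ _).sub (hasSum_thetaSum hq hq0 _ _)).unique
    (h.of_eq (fun k => ?_) rfl)
  simp only [← zpow_natCast, ← zpow_mul, ← zpow_add₀ hq0]
  congr 2 <;> push_cast <;> ring

/-- Bailey's lemma is applied with index `3r` to the first sum and `3r + 1` to the second; the `9r²`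
it contributes turns `6r²` into `15r²`. -/
theorem hasSum_bailey_schurSum {q : ℂ} (hq : ‖q‖ < 1) (hq0 : q ≠ 0) {ε : ℕ} (hε : ε ≤ 1)
    {b₀ b₁ d₁ : ℤ} {B : ℕ → ℂ}
    (h : ∀ n : ℕ, schurSum q b₀ 0 n (n + ε) - schurSum q b₁ d₁ (n - 1) (n + 1 + ε) = B n) :
    HasSum (fun n : ℕ => q ^ (n ^ 2 + ε * n) * B n)
      ((qPochhammerInf q q)⁻¹ *
        (thetaSum q (b₀ + 3 * ε) 0 - thetaSum q (b₁ + 6 + 3 * ε) (d₁ + 1 + ε))) := by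
  have h0 := (hasSum_bailey hq hq0 hε
    (summable_zpow_quadratic hq hq0 (a := 6) (by norm_num) b₀ 0) (fun r => 3 * r)
    (b := fun n => schurSum q b₀ 0 n (n + ε)) fun n =>
    (hasSum_schurSum hq hq0 b₀ 0 n (n + ε)).of_eq (fun r => by
      rw [add_right_comm (n : ℤ)]; rfl) rfl).1
  have h1 := (hasSum_bailey hq hq0 hε
    (summable_zpow_quadratic hq hq0 (a := 6) (by norm_num) b₁ d₁) (fun r => 3 * r + 1)
    (b := fun n => schurSum q b₁ d₁ (n - 1) (n + 1 + ε)) fun n =>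
    (hasSum_schurSum hq hq0 b₁ d₁ (n - 1) (n + 1 + ε)).of_eq (fun r => by
      rw [show (n : ℤ) - (3 * r + 1) = n - 1 - 3 * r by ring,
        show (n : ℤ) + (3 * r + 1) + ε = n + 1 + ε + 3 * r by ring]; rfl) rfl).1
  refine (h0.sub h1).of_eq (fun n => by rw [← h n]; ring) ?_
  rw [← mul_sub]
  congr 2
  · refine tsum_congr fun r => ?_
    rw [← zpow_add₀ hq0]
    congr 1; push_cast; ring
  · refine tsum_congr fun r => ?_
    rw [← zpow_add₀ hq0]
    congr 1; push_cast; ring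

/-- The product side of `∑ q^{n²} / (q; q)_{2n}`, as a difference of theta series. -/
theorem hasSum_slater_even {q : ℂ} (hq : ‖q‖ < 1) (hq0 : q ≠ 0) :
    HasSum (fun n : ℕ => q ^ n ^ 2 * qFactInv q (2 * n)) ((qPochhammerInf q q)⁻¹ *
      (thetaSum q 1 0 - thetaSum q 11 2)) := by
  have h := hasSum_bailey_schurSum hq hq0 zero_le_one (b₀ := 1) (b₁ := 5) (d₁ := 1)
    (B := fun n : ℕ => qFactInv q (2 * n)) fun n => by
      simpa using schurSum_even hq hq0 n
  simpa using h

/-- The product side of `∑ q^{n² + n} / (q; q)_{2n + 1}`, as a difference of theta series. -/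
theorem hasSum_slater_odd {q : ℂ} (hq : ‖q‖ < 1) (hq0 : q ≠ 0) :
    HasSum (fun n : ℕ => q ^ (n ^ 2 + n) * qFactInv q (2 * n + 1)) ((qPochhammerInf q q)⁻¹ *
      (thetaSum q 4 0 - thetaSum q 14 3)) := by
  have h := hasSum_bailey_schurSum hq hq0 le_rfl (b₀ := 1) (b₁ := 5) (d₁ := 1)
    (B := fun n : ℕ => qFactInv q (2 * n + 1)) fun n => by
      simpa [add_assoc] using schurSum_odd hq hq0 n
  simpa using h

/-- The product side of `∑ q^{n² + n} / (q; q)_{2n}`, as a difference of theta series. -/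
theorem hasSum_slater_even' {q : ℂ} (hq : ‖q‖ < 1) (hq0 : q ≠ 0) :
    HasSum (fun n : ℕ => q ^ (n ^ 2 + n) * qFactInv q (2 * n)) ((qPochhammerInf q q)⁻¹ *
      (thetaSum q 2 0 - thetaSum q 8 1)) := by
  have h := hasSum_bailey_schurSum hq hq0 zero_le_one (b₀ := 2) (b₁ := 2) (d₁ := 0)
    (B := fun n : ℕ => q ^ n * qFactInv q (2 * n)) fun n => by
      simpa using schurSum_even' hq hq0 n
  simpa [pow_add, mul_assoc] using h

/-- The product side of `∑ q^{n² + 2n} / (q; q)_{2n + 1}`, as a difference of theta series. -/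
theorem hasSum_slater_odd' {q : ℂ} (hq : ‖q‖ < 1) (hq0 : q ≠ 0) :
    HasSum (fun n : ℕ => q ^ (n ^ 2 + 2 * n) * qFactInv q (2 * n + 1))
      ((qPochhammerInf q q)⁻¹ * (thetaSum q 7 0 - thetaSum q 13 2)) := by
  have h := hasSum_bailey_schurSum hq hq0 le_rfl (b₀ := 4) (b₁ := 4) (d₁ := 0)
    (B := fun n : ℕ => q ^ n * qFactInv q (2 * n + 1)) fun n => by
      simpa [add_assoc] using schurSum_odd' hq hq0 n
  simpa [pow_add, mul_assoc, two_mul] using h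

/-! ### Reduction of the double series to single series. -/

theorem qPochhammerInf_eq_mul (a : ℂ) {q : ℂ} (hq : ‖q‖ < 1) (n : ℕ) :
    qPochhammerInf a q = qPochhammer a q n * qPochhammerInf (a * q ^ n) q := by
  refine tendsto_nhds_unique ((tendsto_qPochhammer a hq).comp (tendsto_add_atTop_nat n))
    (((tendsto_qPochhammer (a * q ^ n) hq).const_mul _).congr fun m => ?_)
  rw [Function.comp_apply, add_comm m n, qPochhammer, qPochhammer, qPochhammer,
    Finset.prod_range_add]
  congr 1
  refine Finset.prod_congr rfl fun k _ => ?_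
  rw [pow_add]; ring

theorem qPochhammer_mul_neg (q : ℂ) (n : ℕ) :
    qPochhammer q q n * qPochhammer (-q) q n = qPochhammer (q ^ 2) (q ^ 2) n := by
  rw [qPochhammer, qPochhammer, qPochhammer, ← Finset.prod_mul_distrib]
  refine Finset.prod_congr rfl fun k _ => ?_
  rw [← pow_mul]; ring

theorem qPochhammerInf_mul_neg {q : ℂ} (hq : ‖q‖ < 1) :
    qPochhammerInf q q * qPochhammerInf (-q) q = qPochhammerInf (q ^ 2) (q ^ 2) := by
  have hq2 : ‖q ^ 2‖ < 1 := by
    rw [norm_pow]; exact pow_lt_one₀ (norm_nonneg q) hq two_ne_zero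
  exact tendsto_nhds_unique (((tendsto_qPochhammer q hq).mul
    (tendsto_qPochhammer (-q) hq)).congr (qPochhammer_mul_neg q)) (tendsto_qPochhammer _ hq2)

theorem hasSum_euler_shifted {q : ℂ} (hq : ‖q‖ < 1) (hq0 : q ≠ 0) (n : ℕ) :
    HasSum (fun j : ℕ => q ^ (j * (j + 1) / 2 + n * j) * (qFactInv q n * qFactInv q j))
      (qPochhammerInf (-q) q * qFactInv (q ^ 2) n) := by
  -- Euler's expansion is stated in a square root `p` of `q`; with `z = p^{2n+1}` its product is
  -- `(-q^{n+1};q)_∞`.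
  obtain ⟨p, rfl⟩ : ∃ p : ℂ, p ^ 2 = q := ⟨q ^ (1 / 2 : ℂ), by
    rw [← Complex.cpow_nat_mul]; norm_num⟩
  have hp0 : p ≠ 0 := fun h => hq0 (by rw [h]; ring)
  have hp : ‖p‖ < 1 := by
    rw [norm_pow] at hq
    exact (pow_lt_one_iff_of_nonneg (norm_nonneg p) two_ne_zero).mp hq
  have h := (hasSum_euler hp hp0 (pow_ne_zero (2 * n + 1) hp0)).mul_left (qFactInv (p ^ 2) n)
  refine h.of_eq (fun j => ?_) ?_
  · have e : p ^ j ^ 2 * (p ^ (2 * n + 1)) ^ j = (p ^ 2) ^ (j * (j + 1) / 2 + n * j) := by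
      have : 2 * (j * (j + 1) / 2) = j * (j + 1) :=
        Nat.mul_div_cancel' (Nat.even_mul_succ_self j).two_dvd
      rw [← pow_mul, ← pow_mul, ← pow_add, mul_add 2, this]
      congr 1; ring
    rw [e]; ring
  · have h1 := qPochhammer_mul_neg (p ^ 2) n
    have h2 := qPochhammer_self_ne_zero hq n
    have hq2 : ‖(p ^ 2) ^ 2‖ < 1 := by
      rw [norm_pow]; exact pow_lt_one₀ (norm_nonneg _) hq two_ne_zero
    have h3 := qPochhammer_self_ne_zero hq2 n
    rw [qPochhammerInf_eq_mul _ hq n, qFactInv_natCast, qFactInv_natCast,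
      show -(p * p ^ (2 * n + 1)) = -p ^ 2 * (p ^ 2) ^ n by ring, ← h1]
    rw [← h1] at h3
    have h4 := right_ne_zero_of_mul h3
    field_simp

theorem hasSum_double_of_hasSum {q : ℂ} (hq : ‖q‖ < 1) (hq0 : q ≠ 0) {e n : ℕ → ℕ}
    (he : ∀ i, i ≤ e i) {T : ℂ}
    (hT : HasSum (fun i : ℕ => q ^ e i * qFactInv (q ^ 2) (n i))
      ((qPochhammerInf (q ^ 2) (q ^ 2))⁻¹ * T)) :
    HasSum (fun x : ℕ × ℕ => q ^ (e x.1 + (x.2 * (x.2 + 1) / 2 + n x.1 * x.2)) /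
      (qPochhammer q q (n x.1) * qPochhammer q q x.2)) (T / qPochhammerInf q q) := by
  have hg := (summable_geometric_of_norm_lt_one hq).hasSum
  have hc : Summable fun x : ℕ × ℕ => q ^ (e x.1 + (x.2 * (x.2 + 1) / 2 + n x.1 * x.2)) := by
    refine Summable.of_norm_bounded (hg.mul_prod hg).summable.norm fun x => ?_
    rw [← pow_add, norm_pow, norm_pow]
    refine pow_le_pow_of_le_one (norm_nonneg q) hq.le (add_le_add (he _) ?_)
    refine le_add_right ((Nat.le_div_iff_mul_le two_pos).mpr ?_)
    rcases Nat.eq_zero_or_pos x.2 with h | h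
    · simp [h]
    · exact Nat.mul_le_mul_left _ (by omega)
  have hs := summable_mul_qFactInv_mul hq hc (fun x => n x.1) (fun x => x.2)
  have h1 := HasSum.prod_fiberwise hs.hasSum
    (g := fun i => q ^ e i * (qPochhammerInf (-q) q * qFactInv (q ^ 2) (n i))) fun i =>
    ((hasSum_euler_shifted hq hq0 (n i)).mul_left (q ^ e i)).of_eq
      (fun j => by rw [pow_add]; ring) rfl
  have h2 := h1.unique ((hT.mul_left (qPochhammerInf (-q) q)).of_eq (fun i => by ring) rfl)
  refine hs.hasSum.of_eq (fun x => ?_) ?_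
  · rw [qFactInv_natCast, qFactInv_natCast, div_eq_mul_inv, mul_inv]
  · rw [h2, ← qPochhammerInf_mul_neg hq]
    have hq2 : ‖q ^ 2‖ < 1 := by
      rw [norm_pow]; exact pow_lt_one₀ (norm_nonneg _) hq two_ne_zero
    have h3 := qPochhammerInf_self_ne_zero hq2
    rw [← qPochhammerInf_mul_neg hq] at h3
    have h4 := left_ne_zero_of_mul h3
    have h5 := right_ne_zero_of_mul h3
    field_simp

/-! ### The degenerate case `q = 0` and the four identities. -/

theorem qPochhammerInf_zero (q : ℂ) : qPochhammerInf 0 q = 1 := by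
  simp [qPochhammerInf]

theorem qPochhammer_zero_left (q : ℂ) (n : ℕ) : qPochhammer 0 q n = 1 := by
  simp [qPochhammer]

theorem hasSum_zero_pow_div {e : ℕ × ℕ → ℕ} (d : ℕ × ℕ → ℕ × ℕ) (he : e (0, 0) = 0)
    (he' : ∀ x, e x = 0 → x = (0, 0)) :
    HasSum (fun x : ℕ × ℕ => (0 : ℂ) ^ e x / (qPochhammer 0 0 (d x).1 * qPochhammer 0 0 (d x).2))
      1 := by
  refine (hasSum_single (0, 0) fun x hx => ?_).of_eq (fun _ => rfl) ?_
  · rw [zero_pow (fun h => hx (he' x h)), zero_div]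
  · simp [he, qPochhammer_zero_left]

theorem mainTheorem11 (q : ℂ) (hq : ‖q‖ < 1) :
    HasSum (fun p : ℕ × ℕ =>
        q ^ (2 * p.1 ^ 2 + 2 * p.1 * p.2 + p.2 * (p.2 + 1) / 2) /
          (qPochhammer q q (2 * p.1) * qPochhammer q q p.2))
      (qPochhammerInfs [q ^ 4, q ^ 16, q ^ 20] (q ^ 20) *
        qPochhammerInfs [q ^ 12, q ^ 28] (q ^ 40) / qPochhammerInf q q) ∧
    HasSum (fun p : ℕ × ℕ =>
        q ^ (2 * p.1 ^ 2 + 2 * p.1 * p.2 + 2 * p.1 + p.2 * (p.2 + 3) / 2) /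
          (qPochhammer q q (2 * p.1 + 1) * qPochhammer q q p.2))
      (qPochhammerInfs [q ^ 6, q ^ 14, q ^ 20] (q ^ 20) *
        qPochhammerInfs [q ^ 8, q ^ 32] (q ^ 40) / qPochhammerInf q q) ∧
    HasSum (fun p : ℕ × ℕ =>
        q ^ (2 * p.1 ^ 2 + 2 * p.1 * p.2 + 2 * p.1 + p.2 * (p.2 + 1) / 2) /
          (qPochhammer q q (2 * p.1) * qPochhammer q q p.2))
      (qPochhammerInfs [q ^ 2, q ^ 18, q ^ 20] (q ^ 20) *
        qPochhammerInfs [q ^ 16, q ^ 24] (q ^ 40) / qPochhammerInf q q) ∧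
    HasSum (fun p : ℕ × ℕ =>
        q ^ (2 * p.1 ^ 2 + 2 * p.1 * p.2 + 4 * p.1 + p.2 * (p.2 + 3) / 2) /
          (qPochhammer q q (2 * p.1 + 1) * qPochhammer q q p.2))
      (qPochhammerInfs [q ^ 8, q ^ 12, q ^ 20] (q ^ 20) *
        qPochhammerInfs [q ^ 4, q ^ 36] (q ^ 40) / qPochhammerInf q q) := by
  have htri : ∀ j : ℕ, j * (j + 3) / 2 = j * (j + 1) / 2 + j := fun j => by
    rw [show j * (j + 3) = j * (j + 1) + j * 2 by ring, Nat.add_mul_div_right _ _ two_pos]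
  have hpos : ∀ j : ℕ, j * (j + 1) / 2 = 0 → j = 0 := fun j h => by
    rcases Nat.div_eq_zero_iff.mp h with h | h
    · omega
    · nlinarith
  rcases eq_or_ne q 0 with rfl | hq0
  · simp only [qPochhammerInfs, List.map_cons, List.map_nil, List.prod_cons, List.prod_nil,
      qPochhammerInf_zero, ne_eq, OfNat.ofNat_ne_zero, not_false_eq_true, zero_pow, mul_one,
      div_one, htri]
    have hx : ∀ x : ℕ × ℕ, 2 * x.1 ^ 2 = 0 → x.2 * (x.2 + 1) / 2 = 0 → x = (0, 0) := by
      rintro ⟨i, j⟩ hi hj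
      simp only [mul_eq_zero, OfNat.ofNat_ne_zero, false_or, pow_eq_zero_iff, ne_eq,
        not_false_eq_true] at hi
      rw [Prod.mk.injEq]
      exact ⟨hi, hpos j hj⟩
    refine ⟨hasSum_zero_pow_div (fun p => (2 * p.1, p.2)) rfl fun x h => ?_,
      hasSum_zero_pow_div (fun p => (2 * p.1 + 1, p.2)) rfl fun x h => ?_,
      hasSum_zero_pow_div (fun p => (2 * p.1, p.2)) rfl fun x h => ?_,
      hasSum_zero_pow_div (fun p => (2 * p.1 + 1, p.2)) rfl fun x h => ?_⟩ <;>
    exact hx x (by omega) (by omega)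
  · have hq2 : ‖q ^ 2‖ < 1 := by
      rw [norm_pow]; exact pow_lt_one₀ (norm_nonneg q) hq two_ne_zero
    have hQ0 := pow_ne_zero 2 hq0
    have hle : ∀ i : ℕ, i ≤ 2 * i ^ 2 := fun i => by nlinarith [Nat.le_self_pow two_ne_zero i]
    have hθ := fun (c : ℕ) (hc : c ≤ 5) => thetaSum_sub_thetaSum hq2 hQ0 hc
    simp only [← pow_mul] at hθ
    have h1 := hasSum_double_of_hasSum hq hq0 (e := fun i => 2 * i ^ 2) (n := fun i => 2 * i) hle
      ((hasSum_slater_even hq2 hQ0).of_eq (fun i => by rw [pow_mul]; norm_cast) rfl)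
    have h2 := hasSum_double_of_hasSum hq hq0 (e := fun i => 2 * (i ^ 2 + i))
      (n := fun i => 2 * i + 1) (fun i => (hle i).trans (by omega))
      ((hasSum_slater_odd hq2 hQ0).of_eq (fun i => by rw [pow_mul]; norm_cast) rfl)
    have h3 := hasSum_double_of_hasSum hq hq0 (e := fun i => 2 * (i ^ 2 + i))
      (n := fun i => 2 * i) (fun i => (hle i).trans (by omega))
      ((hasSum_slater_even' hq2 hQ0).of_eq (fun i => by rw [pow_mul]; norm_cast) rfl)
    have h4 := hasSum_double_of_hasSum hq hq0 (e := fun i => 2 * (i ^ 2 + 2 * i))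
      (n := fun i => 2 * i + 1) (fun i => (hle i).trans (by omega))
      ((hasSum_slater_odd' hq2 hQ0).of_eq (fun i => by rw [pow_mul]; norm_cast) rfl)
    -- The values of `c` are read off from the linear coefficient `3c - 5`, equal to `1, 4, -2, 7`.
    -- The last two cases still need `r ↦ -r`, and for `c = 4` also a shift of `r`, to match the
    -- theta series from Bailey's lemma.
    have t1 := hθ 2 (by norm_num)
    have t2 := hθ 3 (by norm_num)
    have t3 := hθ 1 (by norm_num)
    have t4 := hθ 4 (by norm_num)
    norm_num at t1 t2 t3 t4
    rw [thetaSum_reflect] at t3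
    rw [thetaSum_reflect _ 17, thetaSum_shift _ (-17)] at t4
    norm_num at t3 t4
    rw [t1] at h1
    rw [t2] at h2
    rw [t3] at h3
    rw [t4] at h4
    simp only [qPochhammerInfs, List.map_cons, List.map_nil, List.prod_cons, List.prod_nil, mul_one,
      htri]
    refine ⟨h1.of_eq (fun x => ?_) ?_, h2.of_eq (fun x => ?_) ?_, h3.of_eq (fun x => ?_) ?_,
      h4.of_eq (fun x => ?_) ?_⟩
    · congr 2; ring
    · ring
    · congr 2; ring
    · ring
    · congr 2; ring
    · ring
    · congr 2; ring
    · ring
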